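/- **Theorem 3.2 (Communication height).** Let $K\le L$ be positive integers and let $\Lambda=(V,E)$ be the two-dimensional torus graph $\mathbb T_K\times\mathbb T_L$, that is, $V=\{0,\dots,K-1\}\times\{0,\dots,L-1\}$ with nearest-neighbour edges and periodic boundary conditions. Let $S=\{1,2,3\}$, $\mathcal X=S^V$, and let $\mathbf 1,\mathbf 2,\mathbf 3\in\mathcal X$ be the configurations whose spins are all equal to $1,2,3$, respectively. Given coupling constants $J_{ij}>0$ ($i,j\in S$), let $$H(\sigma)=-\sum_{i\in S}J_{ii}\sum_{\{v,w\}\in E}\mathbf 1_{\{\sigma(v)=\sigma(w)=i\}}+\sum_{i<j}J_{ij}\sum_{\{v,w\}\in E}\mathbf 1_{\{\{\sigma(v),\sigma(w)\}=\{i,j\}\}},\qquad \sigma\in\mathcal X .$$ Assume $J_{11}>J_{22}=J_{33}$ and $J_{12}=J_{13}$, and put $\gamma_1=J_{11}-J_{22}$, $\gamma_{12}=J_{12}+J_{22}$, $\gamma_{23}=J_{23}+J_{22}$. For $h,x>0$ let $$f_h(x)=4\Big(x+\frac h2\Big)\Big\lceil\frac{x+h/2}{h}\Big\rceil-2h\Big(\Big\lceil\frac{x+h/2}{h}\Big\rceil^2-\Big\lceil\frac{x+h/2}{h}\Big\rceil+1\Big).$$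 Assume that * (A) $\frac{2\gamma_{12}+\gamma_1}{2\gamma_1}$ is not an integer; * (B) $f_{\gamma_1}(\gamma_{12})=2(K+1)\gamma_{23}$; * (C) $2\gamma_{12}\ge 4\gamma_{23}+\gamma_1$. A path from $\sigma$ to $\eta$ is a finite sequence $\omega_0=\sigma,\omega_1,\dots,\omega_n=\eta$ in $\mathcal X$ in which consecutive configurations differ at exactly one vertex. Let $\Phi(\sigma,\eta)$ be the minimum, over all paths $\omega$ from $\sigma$ to $\eta$, of $\max_{0\le i\le n}H(\omega_i)$, and let $\Gamma(\sigma,\eta)=\Phi(\sigma,\eta)-H(\sigma)$. Then $$\Gamma(\mathbf 2,\mathbf 1)=\Gamma(\mathbf 3,\mathbf 1)=\Gamma(\mathbf 2,\mathbf 3)=\Gamma^\star,\qquad\text{where }\ \Gamma^\star:=f_{\gamma_1}(\gamma_{12})=2(K+1)\gamma_{23}.$$ -/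

import Mathlib

namespace Potts

/-- The torus `𝕋_K × 𝕋_L`: vertex set `{0,…,K-1} × {0,…,L-1}`, nearest-neighbour edges with
periodic boundary conditions. -/
abbrev torus (K L : ℕ) : SimpleGraph (Fin K × Fin L) :=
  SimpleGraph.boxProd (SimpleGraph.cycleGraph K) (SimpleGraph.cycleGraph L)

/-- The spin set `S`. Its elements `0 < 1 < 2` of `Fin 3` stand for the spin values `1 < 2 < 3`;
they are always referred to by the names `s1`, `s2`, `s3` below. -/
abbrev Spin : Type := Fin 3

/-- Spin value 1. -/
abbrev s1 : Spin := 0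

/-- Spin value 2. -/
abbrev s2 : Spin := 1

/-- Spin value 3. -/
abbrev s3 : Spin := 2

/-- The space of spin configurations `𝒳 = S^V`. -/
abbrev Config (K L : ℕ) : Type := Fin K × Fin L → Spin

/-- The monochromatic configuration with all spins equal to `r`. -/
def mono (K L : ℕ) (r : Spin) : Config K L := fun _ => r

open Classical in
/-- The number of edges `{v, w}` with `{σ v, σ w} = {i, j}` as unordered pairs; for `i = j` these
are the edges with `σ v = σ w = i`. -/
noncomputable def edgeCount {K L : ℕ} (σ : Config K L) (i j : Spin) : ℕ :=
  ((torus K L).edgeFinset.filter (fun e => Sym2.map σ e = s(i, j))).card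

/-- The Hamiltonian
`H(σ) = - ∑ᵢ Jᵢᵢ #{ii-edges of σ} + ∑_{i<j} Jᵢⱼ #{ij-edges of σ}`. -/
noncomputable def energy {K L : ℕ} (J : Spin → Spin → ℝ) (σ : Config K L) : ℝ :=
  -(∑ i, J i i * (edgeCount σ i i : ℝ)) + ∑ i, ∑ j ∈ Finset.Ioi i, J i j * (edgeCount σ i j : ℝ)

/-- The connectivity function of single-spin updates: `1 / (3|V|)` if the two configurations
differ at exactly one vertex and `0` otherwise (a configuration is not connected to itself; the
height of a path does not change when repetitions are inserted or removed). -/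
noncomputable def connectivity {K L : ℕ} (σ η : Config K L) : ℝ :=
  if (Finset.univ.filter (fun v => σ v ≠ η v)).card = 1
    then 1 / (3 * (Fintype.card (Fin K × Fin L) : ℝ)) else 0

/-- A path `ω₀, …, ω_n` from `σ` to `η`: consecutive configurations are connected. -/
structure Path {K L : ℕ} (σ η : Config K L) where
  /-- The number `n` of steps. -/
  length : ℕ
  /-- The configurations `ω₀, …, ω_n`. -/
  toFun : Fin (length + 1) → Config K L
  source_eq : toFun 0 = σ
  target_eq : toFun (Fin.last length) = η
  step : ∀ i : Fin length, 0 < connectivity (toFun i.castSucc) (toFun i.succ)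

/-- The height `Φ_ω = max_i H(ω_i)` of a path. -/
noncomputable def Path.height {K L : ℕ} (J : Spin → Spin → ℝ) {σ η : Config K L}
    (ω : Path σ η) : ℝ :=
  Finset.univ.sup' Finset.univ_nonempty (fun i => energy J (ω.toFun i))

/-- The communication height `Φ(σ, η)`: the minimal height of a path from `σ` to `η`. That the
infimum is a minimum is `isLeast_commHeight` below. -/
noncomputable def commHeight {K L : ℕ} (J : Spin → Spin → ℝ) (σ η : Config K L) : ℝ :=
  sInf (Set.range (fun ω : Path σ η => ω.height J))

/-- `Γ(σ, η) = Φ(σ, η) - H(σ)`. -/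
noncomputable def barrier {K L : ℕ} (J : Spin → Spin → ℝ) (σ η : Config K L) : ℝ :=
  commHeight J σ η - energy J σ

/-- `γ₁ = J₁₁ - J₂₂`. -/
def gamma1 (J : Spin → Spin → ℝ) : ℝ := J s1 s1 - J s2 s2

/-- `γ₁₂ = J₁₂ + J₂₂`. -/
def gamma12 (J : Spin → Spin → ℝ) : ℝ := J s1 s2 + J s2 s2

/-- `γ₂₃ = J₂₃ + J₂₂`. -/
def gamma23 (J : Spin → Spin → ℝ) : ℝ := J s2 s3 + J s2 s2

/-- `f_h(x) = 4 (x + h/2) ⌈(x + h/2)/h⌉ - 2h (⌈(x + h/2)/h⌉² - ⌈(x + h/2)/h⌉ + 1)`. -/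
noncomputable def f (h x : ℝ) : ℝ :=
  4 * (x + h / 2) * (⌈(x + h / 2) / h⌉ : ℝ)
    - 2 * h * ((⌈(x + h / 2) / h⌉ : ℝ) ^ 2 - (⌈(x + h / 2) / h⌉ : ℝ) + 1)

/-- `Γ* = f_{γ₁}(γ₁₂)`. -/
noncomputable def gammaStar (J : Spin → Spin → ℝ) : ℝ := f (gamma1 J) (gamma12 J)

/-- Any two configurations are joined by a path. -/
theorem Path.nonempty {K L : ℕ} (σ η : Config K L) : Nonempty (Path σ η) := by
  classical
  induction h : (Finset.univ.filter (fun v => σ v ≠ η v)).card generalizing σ with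
  | zero =>
    have hs : σ = η := by
      funext v
      by_contra hv
      have : v ∈ Finset.univ.filter (fun v => σ v ≠ η v) := by simpa using hv
      rw [Finset.card_eq_zero.mp h] at this
      simp at this
    exact ⟨⟨0, fun _ => σ, rfl, hs, fun i => i.elim0⟩⟩
  | succ n ih =>
    obtain ⟨v, hv⟩ := Finset.card_pos.mp (by omega :
      0 < (Finset.univ.filter (fun v => σ v ≠ η v)).card)
    have hne : σ v ≠ η v := by simpa using hv
    let τ : Config K L := Function.update σ v (η v)
    have hτ : (Finset.univ.filter (fun w => τ w ≠ η w)) =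
        (Finset.univ.filter (fun w => σ w ≠ η w)).erase v := by
      ext w
      by_cases hw : w = v
      · subst hw; simp [τ]
      · simp [τ, hw]
    obtain ⟨p⟩ := ih τ (by rw [hτ, Finset.card_erase_of_mem hv, h]; rfl)
    have hstep : 0 < connectivity σ τ := by
      have h1 : Finset.univ.filter (fun w => σ w ≠ τ w) = {v} := by
        ext w
        by_cases hw : w = v
        · subst hw; simpa [τ] using hne
        · simp [τ, hw]
      have : Nonempty (Fin K × Fin L) := ⟨v⟩
      have hc : 0 < Fintype.card (Fin K × Fin L) := Fintype.card_pos
      unfold connectivity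
      rw [h1, Finset.card_singleton, if_pos rfl]
      positivity
    refine ⟨⟨p.length + 1, Fin.cons σ p.toFun, rfl, ?_, ?_⟩⟩
    · rw [← Fin.succ_last, Fin.cons_succ, p.target_eq]
    · intro i
      refine Fin.cases ?_ (fun j => ?_) i
      · simpa [p.source_eq] using hstep
      · rw [Fin.cons_succ, ← Fin.succ_castSucc, Fin.cons_succ]
        exact p.step j

/-- The communication height is a minimum. -/
theorem isLeast_commHeight {K L : ℕ} (J : Spin → Spin → ℝ) (σ η : Config K L) :
    IsLeast (Set.range (fun ω : Path σ η => ω.height J)) (commHeight J σ η) := by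
  have hfin : (Set.range (fun ω : Path σ η => ω.height J)).Finite := by
    refine (Set.finite_range (fun τ : Config K L => energy J τ)).subset ?_
    rintro _ ⟨ω, rfl⟩
    obtain ⟨i, -, hi⟩ := Finset.exists_mem_eq_sup' Finset.univ_nonempty
      (fun i => energy J (ω.toFun i))
    exact ⟨ω.toFun i, hi.symm⟩
  have hne : (Set.range (fun ω : Path σ η => ω.height J)).Nonempty := by
    have := Path.nonempty σ η
    exact Set.range_nonempty _
  exact ⟨hne.csInf_mem hfin, fun _ hx => csInf_le hfin.bddBelow hx⟩

end Potts

/-! Write μ = γ₁₂ + γ₁/2 and let l + 1 be the ceiling in f. Up to the constant energy of the phases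
2 and 3, H(σ) is μ times the perimeter of the 1-set, minus 2γ₁ times its volume, plus γ₂₃ times the
number of 23-edges (`energy_eq`).

Upper bound: in a sea of spins 2 or 3, a 1-droplet grows through quasi-squares up to l × (l + 1),
then widens to a full band and fills the torus. The costliest moment is the first cell attached to
the l × (l + 1) rectangle, of cost Γ* (`commHeight_mono_s1_le`). A path from 2 to 3 goes through 1.

Lower bound towards 1: some configuration on the path has exactly l(l + 1) + 1 spins 1, and
isoperimetry gives it energy at least Γ* (`critical_le_energy`). Lower bound from 2 to 3: consider a
moment with K⌊K/2⌋ + 1 spins 3. Either a critical 1-droplet has been passed, or the few spins 1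
cannot make the strip between the two phases cheaper than 2(K + 1)γ₂₃ (`strip_le_energy`), which is
Γ* by (B).

The geometric input is `perimeter_dichotomy`; (B) and (C) supply the room it needs, 2l + 4 ≤ K. -/

namespace Potts

/-! ### Boundaries of subsets of a cycle. -/

/-- The number of edges of the cycle on `Fin n` between `T` and its complement. -/
def cyclePerimeter {n : ℕ} [NeZero n] (T : Finset (Fin n)) : ℕ :=
  (Finset.univ.filter (fun i => ¬ (i ∈ T ↔ i + 1 ∈ T))).card

theorem cyclePerimeter_compl {n : ℕ} [NeZero n] (T : Finset (Fin n)) :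
    cyclePerimeter Tᶜ = cyclePerimeter T := by
  unfold cyclePerimeter
  congr 1
  ext i
  simp only [Finset.mem_filter, Finset.mem_univ, true_and, Finset.mem_compl]
  tauto

open Fin.CommRing in
theorem eq_univ_of_add_one_mem {n : ℕ} [NeZero n] {T : Finset (Fin n)} (hT : T.Nonempty)
    (h : ∀ i ∈ T, i + 1 ∈ T) : T = Finset.univ := by
  obtain ⟨i, hi⟩ := hT
  have hk : ∀ k : ℕ, i + (k : Fin n) ∈ T := by
    intro k
    induction k with
    | zero => simpa using hi
    | succ k ih =>
      have := h _ ih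
      rwa [add_assoc, ← Nat.cast_succ] at this
  ext j
  have := hk (j - i).val
  simpa using this

theorem exists_mem_add_one_notMem {n : ℕ} [NeZero n] {T : Finset (Fin n)} (hT : T.Nonempty)
    (hT' : T ≠ Finset.univ) : ∃ i ∈ T, i + 1 ∉ T := by
  by_contra! h
  exact hT' (eq_univ_of_add_one_mem hT h)

/-- Going round the cycle, one edge leaves `T` and another enters it; they are distinct because they
start in `T` and in its complement. -/
theorem two_le_cyclePerimeter {n : ℕ} [NeZero n] {T : Finset (Fin n)} (hT : T.Nonempty)
    (hT' : T ≠ Finset.univ) : 2 ≤ cyclePerimeter T := by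
  obtain ⟨i, hi, hi'⟩ := exists_mem_add_one_notMem hT hT'
  obtain ⟨j, hj, hj'⟩ := exists_mem_add_one_notMem (T := Tᶜ)
    (by rwa [Finset.nonempty_iff_ne_empty, ne_eq, Finset.compl_eq_empty_iff])
    (by rw [ne_eq, Finset.compl_eq_univ_iff]; exact hT.ne_empty)
  rw [Finset.mem_compl] at hj
  rw [Finset.mem_compl, not_not] at hj'
  have hij : i ≠ j := by rintro rfl; exact hj hi
  rw [cyclePerimeter, ← Finset.card_pair hij]
  apply Finset.card_le_card
  intro k hk
  rw [Finset.mem_insert, Finset.mem_singleton] at hk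
  rcases hk with rfl | rfl <;> simp [*]

theorem cyclePerimeter_empty {n : ℕ} [NeZero n] : cyclePerimeter (∅ : Finset (Fin n)) = 0 := by
  simp [cyclePerimeter]

/-- `T` is an initial segment, so a boundary edge can only start at its maximum or at the
wrap-around vertex n - 1. -/
theorem cyclePerimeter_le_two {n : ℕ} [NeZero n] {T : Finset (Fin n)}
    (hT : ∀ i ∈ T, ∀ j ≤ i, j ∈ T) : cyclePerimeter T ≤ 2 := by
  rcases T.eq_empty_or_nonempty with rfl | hne
  · simp [cyclePerimeter_empty]
  have hn : 0 < n := Nat.pos_of_ne_zero (NeZero.ne n)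
  let last : Fin n := ⟨n - 1, by omega⟩
  refine le_trans (Finset.card_le_card (t := {T.max' hne, last}) ?_) Finset.card_le_two
  intro i hi
  simp only [Finset.mem_filter, Finset.mem_univ, true_and] at hi
  simp only [Finset.mem_insert, Finset.mem_singleton]
  by_cases hl : i.val + 1 < n
  · have hv : (i + 1).val = i.val + 1 := Fin.val_add_one_of_lt' hl
    have hle : i ≤ i + 1 := by rw [Fin.le_def]; omega
    by_cases h1 : i + 1 ∈ T
    · exact absurd ⟨fun _ => h1, fun _ => hT _ h1 _ hle⟩ hi
    · left
      have hiT : i ∈ T := by tauto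
      apply le_antisymm (T.le_max' _ hiT)
      by_contra hlt
      rw [not_le, Fin.lt_def] at hlt
      exact h1 (hT _ (T.max'_mem hne) _ (by rw [Fin.le_def]; omega))
  · right
    apply Fin.ext
    have := i.isLt
    simp only [last]
    omega

/-! ### Perimeter and isoperimetry on the torus. -/

/-- The intersection of `S` with the line of vertices with first coordinate `i`. -/
def row {K L : ℕ} (S : Finset (Fin K × Fin L)) (i : Fin K) : Finset (Fin L) :=
  Finset.univ.filter (fun j => (i, j) ∈ S)

/-- The intersection of `S` with the line of vertices with second coordinate `j`. -/
def col {K L : ℕ} (S : Finset (Fin K × Fin L)) (j : Fin L) : Finset (Fin K) :=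
  Finset.univ.filter (fun i => (i, j) ∈ S)

@[simp] theorem mem_row {K L : ℕ} {S : Finset (Fin K × Fin L)} {i : Fin K} {j : Fin L} :
    j ∈ row S i ↔ (i, j) ∈ S := by simp [row]

@[simp] theorem mem_col {K L : ℕ} {S : Finset (Fin K × Fin L)} {i : Fin K} {j : Fin L} :
    i ∈ col S j ↔ (i, j) ∈ S := by simp [col]

/-- The number of torus edges between `S` and its complement. -/
def perimeter {K L : ℕ} [NeZero K] [NeZero L] (S : Finset (Fin K × Fin L)) : ℕ :=
  ∑ j, cyclePerimeter (col S j) + ∑ i, cyclePerimeter (row S i)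

theorem row_compl {K L : ℕ} (S : Finset (Fin K × Fin L)) (i : Fin K) : row Sᶜ i = (row S i)ᶜ := by
  ext j; simp

theorem col_compl {K L : ℕ} (S : Finset (Fin K × Fin L)) (j : Fin L) : col Sᶜ j = (col S j)ᶜ := by
  ext i; simp

theorem perimeter_compl {K L : ℕ} [NeZero K] [NeZero L] (S : Finset (Fin K × Fin L)) :
    perimeter Sᶜ = perimeter S := by
  simp only [perimeter, row_compl, col_compl, cyclePerimeter_compl]

theorem card_eq_sum_card_row {K L : ℕ} (S : Finset (Fin K × Fin L)) :
    S.card = ∑ i, (row S i).card := by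
  have : S = Finset.univ.filter (fun v : Fin K × Fin L => v ∈ S) := by ext; simp
  conv_lhs => rw [this, Finset.card_filter, Fintype.sum_prod_type]
  simp only [row, Finset.card_filter]

theorem card_eq_sum_card_col {K L : ℕ} (S : Finset (Fin K × Fin L)) :
    S.card = ∑ j, (col S j).card := by
  have : S = Finset.univ.filter (fun v : Fin K × Fin L => v ∈ S) := by ext; simp
  conv_lhs => rw [this, Finset.card_filter, Fintype.sum_prod_type_right]
  simp only [col, Finset.card_filter]

/-- Every line meets a lower set in an initial segment, contributing at most 2, and at most a + b
lines meet it. -/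
theorem perimeter_le_of_isLowerSet {K L : ℕ} [NeZero K] [NeZero L] {S : Finset (Fin K × Fin L)}
    (hS : IsLowerSet (S : Set (Fin K × Fin L))) {a b : ℕ}
    (hab : ∀ v ∈ S, v.1.val < a ∧ v.2.val < b) : perimeter S ≤ 2 * (a + b) := by
  have hcard : ∀ n c : ℕ, (Finset.univ.filter (fun i : Fin n => i.val < c)).card ≤ c := by
    intro n c
    have := Finset.card_le_card_of_injOn (s := Finset.univ.filter (fun i : Fin n => i.val < c))
      (t := Finset.range c) Fin.val (by intro i hi; simpa using hi)
      (Fin.val_injective.injOn)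
    simpa using this
  have h1 : ∑ j, cyclePerimeter (col S j) ≤ 2 * b := by
    calc ∑ j, cyclePerimeter (col S j) ≤ ∑ j : Fin L, if j.val < b then 2 else 0 := by
          apply Finset.sum_le_sum
          intro j _
          split_ifs with h
          · apply cyclePerimeter_le_two
            intro i hi i' hi'
            rw [mem_col] at hi ⊢
            exact hS (show (i', j) ≤ (i, j) from ⟨hi', le_rfl⟩) hi
          · have : col S j = ∅ := by
              ext i
              simpa using fun hi => h (hab _ hi).2
            rw [this, cyclePerimeter_empty]
      _ ≤ 2 * b := by
          rw [← Finset.sum_filter, Finset.sum_const, smul_eq_mul, mul_comm]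
          exact Nat.mul_le_mul_left _ (hcard _ _)
  have h2 : ∑ i, cyclePerimeter (row S i) ≤ 2 * a := by
    calc ∑ i, cyclePerimeter (row S i) ≤ ∑ i : Fin K, if i.val < a then 2 else 0 := by
          apply Finset.sum_le_sum
          intro i _
          split_ifs with h
          · apply cyclePerimeter_le_two
            intro j hj j' hj'
            rw [mem_row] at hj ⊢
            exact hS (show (i, j') ≤ (i, j) from ⟨le_rfl, hj'⟩) hj
          · have : row S i = ∅ := by
              ext j
              simpa using fun hj => h (hab _ hj).1
            rw [this, cyclePerimeter_empty]
      _ ≤ 2 * a := by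
          rw [← Finset.sum_filter, Finset.sum_const, smul_eq_mul, mul_comm]
          exact Nat.mul_le_mul_left _ (hcard _ _)
  unfold perimeter
  omega

/-- The discrete isoperimetric inequality for a set that misses a row and a column. -/
theorem exists_le_perimeter_of_row_col_empty {K L : ℕ} [NeZero K] [NeZero L]
    {S : Finset (Fin K × Fin L)} {i₀ : Fin K} {j₀ : Fin L} (hi : row S i₀ = ∅)
    (hj : col S j₀ = ∅) : ∃ p, 2 * p ≤ perimeter S ∧ 4 * S.card ≤ p ^ 2 := by
  -- `A` and `B` are the projections of `S`. The empty column prevents full rows and vice versa, so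
  -- each met line contributes 2; with p = |A| + |B|, |S| ≤ |A||B| ≤ p²/4.
  set A := Finset.univ.filter (fun i => (row S i).Nonempty) with hA
  set B := Finset.univ.filter (fun j => (col S j).Nonempty) with hB
  have h1 : B.card * 2 ≤ ∑ j, cyclePerimeter (col S j) := by
    rw [← smul_eq_mul, ← Finset.sum_const, hB, Finset.sum_filter]
    apply Finset.sum_le_sum
    intro j _
    split_ifs with h
    · refine two_le_cyclePerimeter h fun hu => ?_
      have : i₀ ∈ col S j := hu ▸ Finset.mem_univ _
      rw [mem_col, ← mem_row, hi] at this
      simp at this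
    · exact Nat.zero_le _
  have h2 : A.card * 2 ≤ ∑ i, cyclePerimeter (row S i) := by
    rw [← smul_eq_mul, ← Finset.sum_const, hA, Finset.sum_filter]
    apply Finset.sum_le_sum
    intro i _
    split_ifs with h
    · refine two_le_cyclePerimeter h fun hu => ?_
      have : j₀ ∈ row S i := hu ▸ Finset.mem_univ _
      rw [mem_row, ← mem_col, hj] at this
      simp at this
    · exact Nat.zero_le _
  have h3 : S.card ≤ A.card * B.card := by
    rw [← Finset.card_product]
    apply Finset.card_le_card
    rintro ⟨i, j⟩ hv
    simp only [hA, hB, Finset.mem_product, Finset.mem_filter, Finset.mem_univ, true_and]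
    exact ⟨⟨j, mem_row.2 hv⟩, ⟨i, mem_col.2 hv⟩⟩
  refine ⟨A.card + B.card, by unfold perimeter; omega, ?_⟩
  zify at h3 ⊢
  nlinarith [sq_nonneg ((A.card : ℤ) - B.card)]

/-- If no member of a family of subsets of a cycle is trivial then the total perimeter is at least
twice the size of the family. -/
theorem two_mul_card_le_sum_cyclePerimeter {k n : ℕ} [NeZero n] {R : Fin k → Finset (Fin n)}
    (h : ∀ i, (R i).Nonempty ∧ R i ≠ Finset.univ) : 2 * k ≤ ∑ i, cyclePerimeter (R i) := by
  calc 2 * k = ∑ _i : Fin k, 2 := by simp [mul_comm]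
    _ ≤ _ := Finset.sum_le_sum fun i _ => two_le_cyclePerimeter (h i).1 (h i).2

/-- If the total perimeter of a family of subsets of a cycle is less than two then all of them are
trivial. -/
theorem dvd_sum_card_of_sum_cyclePerimeter_lt {k n : ℕ} [NeZero n] {R : Fin k → Finset (Fin n)}
    (h : ∑ i, cyclePerimeter (R i) < 2) : n ∣ ∑ i, (R i).card := by
  apply Finset.dvd_sum
  intro i _
  have hi : cyclePerimeter (R i) < 2 :=
    lt_of_le_of_lt (Finset.single_le_sum (f := fun i => cyclePerimeter (R i))
      (fun _ _ => Nat.zero_le _) (Finset.mem_univ i)) h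
  rcases (R i).eq_empty_or_nonempty with he | hne
  · simp [he]
  · by_cases hu : R i = Finset.univ
    · simp [hu]
    · exact absurd (two_le_cyclePerimeter hne hu) (by omega)

/-- The isoperimetric inequality on the torus: either `S` winds around the torus, or `S` or its
complement satisfies the isoperimetric inequality of the plane. -/
theorem perimeter_dichotomy {K L : ℕ} [NeZero K] [NeZero L] (hKL : K ≤ L)
    (S : Finset (Fin K × Fin L)) :
    (2 * K ≤ perimeter S ∧ (2 * K + 2 ≤ perimeter S ∨ K ∣ S.card)) ∨
      ∃ p, 2 * p ≤ perimeter S ∧ (4 * S.card ≤ p ^ 2 ∨ 4 * (K * L - S.card) ≤ p ^ 2) := by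
  -- Without trivial rows the K rows alone give 2K. If the columns add less than 2, all are empty or
  -- full and `S` is a union of columns of K points.
  by_cases hr : ∀ i, (row S i).Nonempty ∧ row S i ≠ Finset.univ
  · left
    have h1 := two_mul_card_le_sum_cyclePerimeter hr
    by_cases h2 : ∑ j, cyclePerimeter (col S j) < 2
    · refine ⟨by unfold perimeter; omega, Or.inr ?_⟩
      rw [card_eq_sum_card_col]
      exact dvd_sum_card_of_sum_cyclePerimeter_lt h2
    · exact ⟨by unfold perimeter; omega, Or.inl (by unfold perimeter; omega)⟩
  by_cases hc : ∀ j, (col S j).Nonempty ∧ col S j ≠ Finset.univ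
  · left
    have h1 := two_mul_card_le_sum_cyclePerimeter hc
    refine ⟨by unfold perimeter; omega, ?_⟩
    by_cases hlt : 2 * K + 2 ≤ perimeter S
    · exact Or.inl hlt
    · right
      -- The L columns already give 2L, so falling short of 2K + 2 forces a square torus.
      have hLK : L = K := by unfold perimeter at hlt; omega
      subst hLK
      rw [card_eq_sum_card_row]
      exact dvd_sum_card_of_sum_cyclePerimeter_lt (by unfold perimeter at hlt; omega)
  right
  push Not at hr hc
  obtain ⟨i₀, hi⟩ := hr
  obtain ⟨j₀, hj⟩ := hc
  -- A trivial row and a trivial column cross, so both are full or both are empty; in the full case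
  -- the complement is used.
  by_cases hm : (i₀, j₀) ∈ S
  · have hi' : row Sᶜ i₀ = ∅ := by
      rw [row_compl, hi ⟨j₀, mem_row.2 hm⟩, Finset.compl_univ]
    have hj' : col Sᶜ j₀ = ∅ := by
      rw [col_compl, hj ⟨i₀, mem_col.2 hm⟩, Finset.compl_univ]
    obtain ⟨p, hp, hp'⟩ := exists_le_perimeter_of_row_col_empty hi' hj'
    rw [perimeter_compl] at hp
    rw [Finset.card_compl, Fintype.card_prod, Fintype.card_fin, Fintype.card_fin] at hp'
    exact ⟨p, hp, Or.inr hp'⟩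
  · have hi' : row S i₀ = ∅ := by
      by_contra hne
      have := hi (Finset.nonempty_iff_ne_empty.2 hne)
      exact hm (mem_row.1 (this ▸ Finset.mem_univ j₀))
    have hj' : col S j₀ = ∅ := by
      by_contra hne
      have := hj (Finset.nonempty_iff_ne_empty.2 hne)
      exact hm (mem_col.1 (this ▸ Finset.mem_univ i₀))
    obtain ⟨p, hp, hp'⟩ := exists_le_perimeter_of_row_col_empty hi' hj'
    exact ⟨p, hp, Or.inl hp'⟩

/-! ### The energy through perimeters and volume. -/

theorem cycleGraph_adj_iff {n : ℕ} [NeZero n] (hn : 3 ≤ n) {u v : Fin n} :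
    (SimpleGraph.cycleGraph n).Adj u v ↔ v = u + 1 ∨ u = v + 1 := by
  obtain ⟨k, rfl⟩ := Nat.exists_eq_add_of_le' (show 2 ≤ n by omega)
  rw [SimpleGraph.cycleGraph_adj, sub_eq_iff_eq_add', sub_eq_iff_eq_add', or_comm]

theorem fin_add_one_ne {n : ℕ} [NeZero n] (hn : 3 ≤ n) (i : Fin n) : i + 1 ≠ i := by
  intro h
  rw [add_eq_left, Fin.ext_iff, Fin.val_one', Nat.mod_eq_of_lt (by omega)] at h
  simp at h

theorem fin_add_one_add_one_ne {n : ℕ} [NeZero n] (hn : 3 ≤ n) (i : Fin n) : i + 1 + 1 ≠ i := by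
  intro h
  rw [add_assoc, add_eq_left, Fin.ext_iff, Fin.val_add, Fin.val_one',
    Nat.mod_eq_of_lt (show 1 < n by omega), Nat.mod_eq_of_lt (by omega)] at h
  simp at h

/-- The neighbour of a vertex of the torus in one of the two positive directions. -/
def next {K L : ℕ} [NeZero K] [NeZero L] (x : (Fin K × Fin L) × Bool) : Fin K × Fin L :=
  if x.2 then (x.1.1 + 1, x.1.2) else (x.1.1, x.1.2 + 1)

/-- Side length at least 3 excludes loops (i + 1 = i) and double edges (i + 2 = i), so each edge has
a unique positive orientation. -/
theorem injective_edge_next {K L : ℕ} [NeZero K] [NeZero L] (hK : 3 ≤ K) (hL : 3 ≤ L) :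
    Function.Injective (fun x : (Fin K × Fin L) × Bool => s(x.1, next x)) := by
  rintro ⟨⟨i, j⟩, d⟩ ⟨⟨i', j'⟩, d'⟩ h
  have h1 := fin_add_one_ne hK
  have h2 := fin_add_one_add_one_ne hK
  have h3 := fin_add_one_ne hL
  have h4 := fin_add_one_add_one_ne hL
  rw [Sym2.eq_iff] at h
  rcases h with ⟨h, h'⟩ | ⟨h, h'⟩
  · obtain ⟨rfl, rfl⟩ := Prod.ext_iff.1 h
    have h5 := h1 i
    have h6 := h3 j
    cases d <;> cases d' <;> simp_all [next]
  · cases d <;> cases d' <;> simp only [next, Prod.mk.injEq, if_true, if_false, reduceCtorEq] at h h'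
    · exact absurd (h.2 ▸ h'.2) (h4 j')
    · exact absurd (h.2 ▸ h'.2) (h3 _)
    · exact absurd (h.1 ▸ h'.1) (h1 _)
    · exact absurd (h.1 ▸ h'.1) (h2 _)

theorem mem_torus_edgeSet_iff {K L : ℕ} [NeZero K] [NeZero L] (hK : 3 ≤ K) (hL : 3 ≤ L)
    (e : Sym2 (Fin K × Fin L)) :
    e ∈ (torus K L).edgeSet ↔ ∃ x : (Fin K × Fin L) × Bool, s(x.1, next x) = e := by
  induction e with
  | _ v w =>
    obtain ⟨i, j⟩ := v
    obtain ⟨i', j'⟩ := w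
    rw [SimpleGraph.mem_edgeSet, SimpleGraph.boxProd_adj, cycleGraph_adj_iff hK,
      cycleGraph_adj_iff hL]
    constructor
    · rintro (⟨h | h, h'⟩ | ⟨h | h, h'⟩)
      · exact ⟨((i, j), true), by simp_all [next]⟩
      · exact ⟨((i', j'), true), by rw [Sym2.eq_swap]; simp_all [next]⟩
      · exact ⟨((i, j), false), by simp_all [next]⟩
      · exact ⟨((i', j'), false), by rw [Sym2.eq_swap]; simp_all [next]⟩
    · rintro ⟨⟨⟨a, b⟩, d⟩, h⟩
      rw [Sym2.eq_iff] at h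
      cases d <;> simp only [next, Prod.mk.injEq, if_true, if_false, reduceCtorEq] at h <;>
        rcases h with ⟨⟨rfl, rfl⟩, rfl, rfl⟩ | ⟨⟨rfl, rfl⟩, rfl, rfl⟩ <;> simp

theorem edgeCount_eq_sum {K L : ℕ} [NeZero K] [NeZero L] (hK : 3 ≤ K) (hL : 3 ≤ L)
    (σ : Config K L) (i j : Spin) :
    (edgeCount σ i j : ℝ) =
      ∑ x : (Fin K × Fin L) × Bool, if s(σ x.1, σ (next x)) = s(i, j) then (1 : ℝ) else 0 := by
  classical
  have hE : ∀ inst : Fintype (torus K L).edgeSet, @SimpleGraph.edgeFinset _ (torus K L) inst =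
      Finset.univ.image (fun x : (Fin K × Fin L) × Bool => s(x.1, next x)) := by
    intro inst
    ext e
    rw [SimpleGraph.mem_edgeFinset, mem_torus_edgeSet_iff hK hL]
    simp
  rw [edgeCount, hE, Finset.card_filter, Finset.sum_image (injective_edge_next hK hL).injOn]
  push_cast
  simp only [Sym2.map_mk]
  congr!

/-- The set of vertices with spin in `A`. -/
def spinSet {K L : ℕ} (σ : Config K L) (A : Finset Spin) : Finset (Fin K × Fin L) :=
  Finset.univ.filter (fun v => σ v ∈ A)

theorem perimeter_spinSet {K L : ℕ} [NeZero K] [NeZero L] (σ : Config K L) (A : Finset Spin) :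
    (perimeter (spinSet σ A) : ℝ) =
      ∑ x : (Fin K × Fin L) × Bool, if (σ x.1 ∈ A ↔ σ (next x) ∈ A) then (0 : ℝ) else 1 := by
  rw [Fintype.sum_prod_type]
  simp only [Fintype.sum_bool, Finset.sum_add_distrib, next, if_true, Bool.false_eq_true, if_false]
  rw [perimeter, Nat.cast_add, Nat.cast_sum, Nat.cast_sum, Fintype.sum_prod_type_right,
    Fintype.sum_prod_type]
  simp only [cyclePerimeter, Finset.card_filter, mem_col, mem_row, spinSet, Finset.mem_filter,
    Finset.mem_univ, true_and, ite_not, Nat.cast_sum, Nat.cast_ite, Nat.cast_zero, Nat.cast_one]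

/-- The torus is 4-regular. This turns volume into a sum over edges, which makes the energy formula
an edgewise identity. -/
theorem four_mul_card_spinSet {K L : ℕ} [NeZero K] [NeZero L] (σ : Config K L) (A : Finset Spin) :
    4 * ((spinSet σ A).card : ℝ) = ∑ x : (Fin K × Fin L) × Bool,
      ((if σ x.1 ∈ A then (1 : ℝ) else 0) + if σ (next x) ∈ A then 1 else 0) := by
  have hc : ((spinSet σ A).card : ℝ) = ∑ v, if σ v ∈ A then (1 : ℝ) else 0 := by
    rw [spinSet, Finset.card_filter]; push_cast; rfl
  rw [Fintype.sum_prod_type]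
  simp only [Fintype.sum_bool, Finset.sum_add_distrib, next, if_true, Bool.false_eq_true, if_false]
  have h1 := Equiv.sum_comp ((Equiv.addRight (1 : Fin K)).prodCongr (Equiv.refl (Fin L)))
    (fun v => if σ v ∈ A then (1 : ℝ) else 0)
  have h2 := Equiv.sum_comp ((Equiv.refl (Fin K)).prodCongr (Equiv.addRight (1 : Fin L)))
    (fun v => if σ v ∈ A then (1 : ℝ) else 0)
  simp only [Equiv.prodCongr_apply, Prod.map, Equiv.coe_addRight, Equiv.refl_apply] at h1 h2
  rw [h1, h2, ← hc]
  ring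

/-- The energy of a configuration in terms of the number of spins `1` and of the perimeters of the
sets with spin `1`, with spin `3` and with spin `1` or `3`. -/
theorem energy_eq {K L : ℕ} [NeZero K] [NeZero L] (hK : 3 ≤ K) (hL : 3 ≤ L)
    {J : Spin → Spin → ℝ} (hJ22 : J s2 s2 = J s3 s3) (hJ12 : J s1 s2 = J s1 s3)
    (σ : Config K L) :
    energy J σ = -(2 * K * L * J s2 s2)
      + ((gamma12 J + gamma1 J / 2) * perimeter (spinSet σ {s1})
        - 2 * gamma1 J * (spinSet σ {s1}).card)
      + gamma23 J * ((perimeter (spinSet σ {s3}) + perimeter (spinSet σ {s1, s3})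
        - perimeter (spinSet σ {s1})) / 2) := by
  have hcard : (2 * K * L : ℝ) = ∑ _x : (Fin K × Fin L) × Bool, (1 : ℝ) := by
    simp; ring
  have hn : 2 * gamma1 J * ((spinSet σ {s1}).card : ℝ)
      = gamma1 J / 2 * (4 * ((spinSet σ {s1}).card : ℝ)) := by ring
  have hI : (Finset.Ioi (0 : Fin 3) = {1, 2}) ∧ (Finset.Ioi (1 : Fin 3) = {2}) ∧
      (Finset.Ioi (2 : Fin 3) = ∅) := by decide
  rw [hn, hcard, four_mul_card_spinSet, perimeter_spinSet, perimeter_spinSet, perimeter_spinSet,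
    energy, Fin.sum_univ_three, Fin.sum_univ_three, hI.1, hI.2.1, hI.2.2,
    Finset.sum_pair (by decide), Finset.sum_singleton, Finset.sum_empty]
  simp only [edgeCount_eq_sum hK hL, add_zero, Finset.mul_sum, Finset.sum_mul, Finset.sum_div,
    ← Finset.sum_add_distrib, ← Finset.sum_sub_distrib, ← Finset.sum_neg_distrib]
  -- What remains is a check over the nine spin pairs of one edge. The boundaries of {3} and {1,3}
  -- together count each 23-edge twice and each 12- or 13-edge once; subtracting the boundary of {1}
  -- leaves twice the 23-edges.
  apply Finset.sum_congr rfl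
  intro x _
  generalize σ x.1 = a
  generalize σ (next x) = b
  simp only [s1, s2, s3] at hJ22 hJ12
  fin_cases a <;> fin_cases b <;>
    simp [gamma1, gamma12, gamma23, s1, s2, s3, ← hJ22, ← hJ12] <;> ring

/-- The difference of the two sides is twice the number of 23-edges. -/
theorem perimeter_spinSet_le {K L : ℕ} [NeZero K] [NeZero L] (σ : Config K L) :
    (perimeter (spinSet σ {s1}) : ℝ) ≤
      perimeter (spinSet σ {s3}) + perimeter (spinSet σ {s1, s3}) := by
  simp only [perimeter_spinSet, ← Finset.sum_add_distrib]
  apply Finset.sum_le_sum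
  intro x _
  generalize σ x.1 = a
  generalize σ (next x) = b
  fin_cases a <;> fin_cases b <;> simp [s1, s3]

/-! ### Communication height as reachability below a level. -/

theorem connectivity_pos_iff {K L : ℕ} {σ η : Config K L} :
    0 < connectivity σ η ↔ (Finset.univ.filter (fun v => σ v ≠ η v)).card = 1 := by
  unfold connectivity
  split_ifs with h
  · obtain ⟨v, -⟩ := Finset.card_pos.1 (h ▸ Nat.one_pos)
    have : Nonempty (Fin K × Fin L) := ⟨v⟩
    have hc : 0 < Fintype.card (Fin K × Fin L) := Fintype.card_pos
    exact iff_of_true (by positivity) h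
  · exact iff_of_false (lt_irrefl _) h

theorem connectivity_pos_comm {K L : ℕ} {σ η : Config K L} :
    0 < connectivity σ η ↔ 0 < connectivity η σ := by
  simp only [connectivity_pos_iff, ne_comm]

/-- `σ` and `η` have energy at most `c` and differ by a single spin update. -/
def StepBelow {K L : ℕ} (J : Spin → Spin → ℝ) (c : ℝ) (σ η : Config K L) : Prop :=
  0 < connectivity σ η ∧ energy J σ ≤ c ∧ energy J η ≤ c

theorem StepBelow.symm {K L : ℕ} {J : Spin → Spin → ℝ} {c : ℝ} {σ η : Config K L}
    (h : StepBelow J c σ η) : StepBelow J c η σ :=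
  ⟨connectivity_pos_comm.1 h.1, h.2.2, h.2.1⟩

theorem Path.energy_le_height {K L : ℕ} (J : Spin → Spin → ℝ) {σ η : Config K L} (ω : Path σ η)
    (i : Fin (ω.length + 1)) : energy J (ω.toFun i) ≤ ω.height J :=
  Finset.le_sup' (fun i => energy J (ω.toFun i)) (Finset.mem_univ i)

/-- The communication height is at most `c` if and only if the two configurations are joined by
single spin updates between configurations with energy at most `c`. -/
theorem commHeight_le_iff {K L : ℕ} {J : Spin → Spin → ℝ} {c : ℝ} {σ η : Config K L} :
    commHeight J σ η ≤ c ↔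
      energy J σ ≤ c ∧ Relation.ReflTransGen (StepBelow J c) σ η := by
  constructor
  · intro h
    obtain ⟨ω, hω⟩ := (isLeast_commHeight J σ η).1
    have hle : ∀ i, energy J (ω.toFun i) ≤ c := fun i =>
      (ω.energy_le_height J i).trans ((show ω.height J = _ from hω).le.trans h)
    refine ⟨ω.source_eq ▸ hle 0, ?_⟩
    have key : ∀ i : Fin (ω.length + 1), Relation.ReflTransGen (StepBelow J c) σ (ω.toFun i) := by
      intro i
      induction i using Fin.induction with
      | zero => rw [ω.source_eq]
      | succ i ih => exact ih.tail ⟨ω.step i, hle _, hle _⟩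
    exact ω.target_eq ▸ key (Fin.last _)
  · rintro ⟨hσ, h⟩
    suffices ∃ ω : Path σ η, ∀ i, energy J (ω.toFun i) ≤ c by
      obtain ⟨ω, hω⟩ := this
      exact ((isLeast_commHeight J σ η).2 ⟨ω, rfl⟩).trans (Finset.sup'_le _ _ fun i _ => hω i)
    induction h using Relation.ReflTransGen.head_induction_on with
    | refl => exact ⟨⟨0, fun _ => η, rfl, rfl, fun i => i.elim0⟩, fun _ => hσ⟩
    | head h _ ih =>
      obtain ⟨p, hp⟩ := ih h.2.2
      refine ⟨⟨p.length + 1, Fin.cons _ p.toFun, rfl, ?_, ?_⟩, ?_⟩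
      · rw [← Fin.succ_last, Fin.cons_succ, p.target_eq]
      · intro i
        refine Fin.cases ?_ (fun j => ?_) i
        · simpa [p.source_eq] using h.1
        · rw [Fin.cons_succ, ← Fin.succ_castSucc, Fin.cons_succ]
          exact p.step j
      · intro i
        refine Fin.cases ?_ (fun j => ?_) i
        · exact h.2.1
        · exact hp j

theorem energy_le_of_commHeight_le {K L : ℕ} {J : Spin → Spin → ℝ} {c : ℝ} {σ η : Config K L}
    (h : commHeight J σ η ≤ c) : energy J η ≤ c := by
  obtain ⟨h1, h2⟩ := commHeight_le_iff.1 h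
  rcases Relation.ReflTransGen.cases_tail h2 with rfl | ⟨_, _, h3⟩
  · exact h1
  · exact h3.2.2

theorem commHeight_le_trans {K L : ℕ} {J : Spin → Spin → ℝ} {c : ℝ} {σ τ η : Config K L}
    (h : commHeight J σ τ ≤ c) (h' : commHeight J τ η ≤ c) : commHeight J σ η ≤ c := by
  rw [commHeight_le_iff] at *
  exact ⟨h.1, h.2.trans h'.2⟩

theorem commHeight_le_symm {K L : ℕ} {J : Spin → Spin → ℝ} {c : ℝ} {σ η : Config K L}
    (h : commHeight J σ η ≤ c) : commHeight J η σ ≤ c := by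
  refine commHeight_le_iff.2 ⟨energy_le_of_commHeight_le h, ?_⟩
  have := (commHeight_le_iff.1 h).2
  induction this with
  | refl => exact .refl
  | tail h1 h2 ih =>
    exact .head h2.symm (ih (commHeight_le_iff.2 ⟨(commHeight_le_iff.1 h).1, h1⟩))

theorem commHeight_le_step {K L : ℕ} {J : Spin → Spin → ℝ} {c : ℝ} {σ τ η : Config K L}
    (h : commHeight J σ τ ≤ c) (h' : 0 < connectivity τ η) (hη : energy J η ≤ c) :
    commHeight J σ η ≤ c :=
  commHeight_le_iff.2 ⟨(commHeight_le_iff.1 h).1,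
    (commHeight_le_iff.1 h).2.tail ⟨h', energy_le_of_commHeight_le h, hη⟩⟩

theorem card_spinSet_le_of_connectivity_pos {K L : ℕ} {σ η : Config K L}
    (h : 0 < connectivity σ η) (A : Finset Spin) :
    (spinSet η A).card ≤ (spinSet σ A).card + 1 := by
  rw [connectivity_pos_iff, Finset.card_eq_one] at h
  obtain ⟨v, hv⟩ := h
  refine (Finset.card_le_card (t := insert v (spinSet σ A)) fun w hw => ?_).trans
    (Finset.card_insert_le _ _)
  rw [Finset.mem_insert]
  by_cases hwv : σ w = η w
  · right
    simpa [spinSet, hwv] using hw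
  · left
    have : w ∈ Finset.univ.filter (fun v => σ v ≠ η v) := by simpa using hwv
    simpa [hv] using this

/-- On the way to a configuration with at least `N` spins in `A` there is one with exactly `N`. -/
theorem exists_card_spinSet_eq {K L : ℕ} {J : Spin → Spin → ℝ} {c : ℝ} {σ η : Config K L}
    (h : commHeight J σ η ≤ c) {A : Finset Spin} {N : ℕ} (hσ : (spinSet σ A).card ≤ N)
    (hη : N ≤ (spinSet η A).card) :
    ∃ τ, (spinSet τ A).card = N ∧ commHeight J σ τ ≤ c := by
  simp only [commHeight_le_iff] at *
  obtain ⟨hc, h⟩ := h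
  induction h with
  | refl => exact ⟨σ, le_antisymm hσ hη, hc, .refl⟩
  | @tail τ η h1 h2 ih =>
    by_cases hN : N ≤ (spinSet τ A).card
    · exact ih hN
    · have := card_spinSet_le_of_connectivity_pos h2.1 A
      exact ⟨η, by omega, hc, h1.tail h2⟩

/-! ### Upper bound: growing a 1-droplet. -/

/-- The configuration with spin `1` on `S` and spin `r` elsewhere. -/
def fill {K L : ℕ} (r : Spin) (S : Finset (Fin K × Fin L)) : Config K L :=
  fun v => if v ∈ S then s1 else r

theorem fill_empty (K L : ℕ) (r : Spin) : fill r ∅ = mono K L r := by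
  ext v; simp [fill, mono]

theorem fill_univ (K L : ℕ) (r : Spin) : fill r Finset.univ = mono K L s1 := by
  ext v; simp [fill, mono]

theorem connectivity_fill_insert_pos {K L : ℕ} {r : Spin} (hr : r ≠ s1)
    {S : Finset (Fin K × Fin L)} {v : Fin K × Fin L} (hv : v ∉ S) :
    0 < connectivity (fill r S) (fill r (insert v S)) := by
  rw [connectivity_pos_iff, Finset.card_eq_one]
  refine ⟨v, ?_⟩
  ext w
  by_cases hw : w = v
  · subst hw; simp [fill, hv, hr]
  · simp [fill, hw]

theorem perimeter_empty {K L : ℕ} [NeZero K] [NeZero L] :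
    perimeter (∅ : Finset (Fin K × Fin L)) = 0 := by
  simp [perimeter, row, col, cyclePerimeter_empty]

theorem perimeter_univ {K L : ℕ} [NeZero K] [NeZero L] :
    perimeter (Finset.univ : Finset (Fin K × Fin L)) = 0 := by
  rw [← Finset.compl_empty, perimeter_compl, perimeter_empty]

/-- Only 1 and `r` occur, so there are no 23-edges, and the energy is the same for r = 2 and r = 3.
-/
theorem energy_fill {K L : ℕ} [NeZero K] [NeZero L] (hK : 3 ≤ K) (hL : 3 ≤ L)
    {J : Spin → Spin → ℝ} (hJ22 : J s2 s2 = J s3 s3) (hJ12 : J s1 s2 = J s1 s3) {r : Spin}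
    (hr : r ≠ s1) (S : Finset (Fin K × Fin L)) :
    energy J (fill r S) = -(2 * K * L * J s2 s2)
      + ((gamma12 J + gamma1 J / 2) * perimeter S - 2 * gamma1 J * S.card) := by
  have h1 : spinSet (fill r S) {s1} = S := by
    ext v; by_cases hv : v ∈ S <;> simp [spinSet, fill, hv, hr]
  rw [energy_eq hK hL hJ22 hJ12, h1]
  have h23 : r = s2 ∨ r = s3 := by
    clear h1; revert hr; revert r; decide
  rcases h23 with rfl | rfl
  · have h2 : spinSet (fill s2 S) {s3} = ∅ := by
      ext v; by_cases hv : v ∈ S <;> simp [spinSet, fill, hv, s1, s2, s3]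
    have h3 : spinSet (fill s2 S) {s1, s3} = S := by
      ext v; by_cases hv : v ∈ S <;> simp [spinSet, fill, hv, s1, s2, s3]
    rw [h2, h3, perimeter_empty]
    push_cast; ring
  · have h2 : spinSet (fill s3 S) {s3} = Sᶜ := by
      ext v; by_cases hv : v ∈ S <;> simp [spinSet, fill, hv, s1, s3]
    have h3 : spinSet (fill s3 S) {s1, s3} = Finset.univ := by
      ext v; by_cases hv : v ∈ S <;> simp [spinSet, fill, hv, s1, s3]
    rw [h2, h3, perimeter_compl, perimeter_univ]
    push_cast; ring

theorem energy_mono {K L : ℕ} [NeZero K] [NeZero L] (hK : 3 ≤ K) (hL : 3 ≤ L)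
    {J : Spin → Spin → ℝ} (hJ22 : J s2 s2 = J s3 s3) (hJ12 : J s1 s2 = J s1 s3) {r : Spin}
    (hr : r ≠ s1) : energy J (mono K L r) = -(2 * K * L * J s2 s2) := by
  rw [← fill_empty, energy_fill hK hL hJ22 hJ12 hr, perimeter_empty]
  simp

/-- The rectangle `a × b` together with a part of length `r` of the next row. -/
def rectRow (K L a b r : ℕ) : Finset (Fin K × Fin L) :=
  Finset.univ.filter (fun v => (v.1.val < a ∧ v.2.val < b) ∨ (v.1.val = a ∧ v.2.val < r))

/-- The rectangle `a × b` together with a part of length `r` of the next column. -/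
def rectCol (K L a b r : ℕ) : Finset (Fin K × Fin L) :=
  Finset.univ.filter (fun v => (v.1.val < a ∧ v.2.val < b) ∨ (v.2.val = b ∧ v.1.val < r))

/-- The rectangle `a × b`. -/
def rect (K L a b : ℕ) : Finset (Fin K × Fin L) :=
  Finset.univ.filter (fun v => v.1.val < a ∧ v.2.val < b)

theorem perimeter_rectRow_le {K L a b r : ℕ} [NeZero K] [NeZero L] (hr : r ≤ b) :
    perimeter (rectRow K L a b r) ≤ 2 * (a + b + 1) := by
  rw [show a + b + 1 = a + 1 + b by ring]
  apply perimeter_le_of_isLowerSet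
  · rintro ⟨i, j⟩ ⟨i', j'⟩ ⟨hi, hj⟩ h
    simp only [Fin.le_def] at hi hj
    simp only [rectRow, Finset.coe_filter, Finset.mem_univ, true_and, Set.mem_ofPred_eq] at h ⊢
    omega
  · intro v hv
    simp only [rectRow, Finset.mem_filter, Finset.mem_univ, true_and] at hv
    omega

theorem perimeter_rectCol_le {K L a b r : ℕ} [NeZero K] [NeZero L] (hr : r ≤ a) :
    perimeter (rectCol K L a b r) ≤ 2 * (a + b + 1) := by
  rw [show a + b + 1 = a + (b + 1) by ring]
  apply perimeter_le_of_isLowerSet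
  · rintro ⟨i, j⟩ ⟨i', j'⟩ ⟨hi, hj⟩ h
    simp only [Fin.le_def] at hi hj
    simp only [rectCol, Finset.coe_filter, Finset.mem_univ, true_and, Set.mem_ofPred_eq] at h ⊢
    omega
  · intro v hv
    simp only [rectCol, Finset.mem_filter, Finset.mem_univ, true_and] at hv
    omega

/-- The `1`-droplet `S` in the sea of spins `r` has size `n` and can be grown from nothing below
the energy level `c`. -/
def Grown {K L : ℕ} (J : Spin → Spin → ℝ) (c : ℝ) (r : Spin) (S : Finset (Fin K × Fin L))
    (n : ℕ) : Prop :=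
  S.card = n ∧ commHeight J (mono K L r) (fill r S) ≤ c

theorem Grown.insert_vertex {K L : ℕ} [NeZero K] [NeZero L] (hK : 3 ≤ K) (hL : 3 ≤ L)
    {J : Spin → Spin → ℝ} (hJ22 : J s2 s2 = J s3 s3) (hJ12 : J s1 s2 = J s1 s3) {r : Spin}
    (hr : r ≠ s1) {c : ℝ} {S : Finset (Fin K × Fin L)} {n : ℕ} (h : Grown J c r S n)
    {v : Fin K × Fin L} (hv : v ∉ S)
    (hc : -(2 * K * L * J s2 s2) + ((gamma12 J + gamma1 J / 2) * perimeter (insert v S)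
      - 2 * gamma1 J * (n + 1 : ℕ)) ≤ c) : Grown J c r (insert v S) (n + 1) := by
  have hn : (insert v S).card = n + 1 := by rw [Finset.card_insert_of_notMem hv, h.1]
  refine ⟨hn, commHeight_le_step h.2 (connectivity_fill_insert_pos hr hv) ?_⟩
  rwa [energy_fill hK hL hJ22 hJ12 hr, hn]

/-- An upper bound for the energy, relative to the monochromatic configuration, of droplets between
the rectangle `a × b` and the rectangle with one more line. -/
noncomputable def lineCost (J : Spin → Spin → ℝ) (a b : ℕ) : ℝ :=
  (gamma12 J + gamma1 J / 2) * (2 * (a + b + 1)) - 2 * gamma1 J * (a * b + 1)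

/-- While a line is being filled the perimeter bound stays fixed and volume only lowers the energy,
so the first cell (k = 0) is the worst. -/
theorem energy_bound_of_lineCost_le {J : Spin → Spin → ℝ} (h1 : 0 < gamma1 J)
    (h12 : 0 < gamma12 J) {a b k p : ℕ} {e c : ℝ} (hc : e + lineCost J a b ≤ c)
    (hp : p ≤ 2 * (a + b + 1)) :
    e + ((gamma12 J + gamma1 J / 2) * p - 2 * gamma1 J * (a * b + k + 1 : ℕ)) ≤ c := by
  have hp' : (p : ℝ) ≤ 2 * (a + b + 1) := by exact_mod_cast hp
  have h2 : (gamma12 J + gamma1 J / 2) * p ≤ (gamma12 J + gamma1 J / 2) * (2 * (a + b + 1)) :=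
    mul_le_mul_of_nonneg_left hp' (by positivity)
  have h3 : 0 ≤ 2 * gamma1 J * (k : ℝ) := by positivity
  unfold lineCost at hc
  push_cast
  linarith

theorem Grown.rect_add_row {K L : ℕ} [NeZero K] [NeZero L] (hK : 3 ≤ K) (hL : 3 ≤ L)
    {J : Spin → Spin → ℝ} (hJ22 : J s2 s2 = J s3 s3) (hJ12 : J s1 s2 = J s1 s3) {r : Spin}
    (hr : r ≠ s1) (h1 : 0 < gamma1 J) (h12 : 0 < gamma12 J) {c : ℝ} {a b : ℕ} (ha : a < K)
    (hb : b ≤ L) (hc : -(2 * K * L * J s2 s2) + lineCost J a b ≤ c)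
    (h : Grown J c r (rect K L a b) (a * b)) : Grown J c r (rect K L (a + 1) b) ((a + 1) * b) := by
  have key : ∀ k ≤ b, Grown J c r (rectRow K L a b k) (a * b + k) := by
    intro k
    induction k with
    | zero =>
      intro _
      have : rectRow K L a b 0 = rect K L a b := by
        ext v; simp [rectRow, rect]
      rwa [this]
    | succ k ih =>
      intro hk
      have hins : rectRow K L a b (k + 1) =
          insert (⟨a, ha⟩, ⟨k, by omega⟩) (rectRow K L a b k) := by
        ext ⟨i, j⟩
        simp only [rectRow, Finset.mem_filter, Finset.mem_univ, true_and, Finset.mem_insert,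
          Prod.mk.injEq, Fin.ext_iff]
        omega
      have hp := perimeter_rectRow_le (K := K) (L := L) (a := a) hk
      rw [hins] at hp ⊢
      exact (ih (by omega)).insert_vertex hK hL hJ22 hJ12 hr (by simp [rectRow])
        (energy_bound_of_lineCost_le h1 h12 hc hp)
  have hrect : rectRow K L a b b = rect K L (a + 1) b := by
    ext v
    simp only [rectRow, rect, Finset.mem_filter, Finset.mem_univ, true_and]
    omega
  rw [← hrect, add_mul, one_mul]
  exact key b le_rfl

theorem Grown.rect_add_col {K L : ℕ} [NeZero K] [NeZero L] (hK : 3 ≤ K) (hL : 3 ≤ L)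
    {J : Spin → Spin → ℝ} (hJ22 : J s2 s2 = J s3 s3) (hJ12 : J s1 s2 = J s1 s3) {r : Spin}
    (hr : r ≠ s1) (h1 : 0 < gamma1 J) (h12 : 0 < gamma12 J) {c : ℝ} {a b : ℕ} (ha : a ≤ K)
    (hb : b < L) (hc : -(2 * K * L * J s2 s2) + lineCost J a b ≤ c)
    (h : Grown J c r (rect K L a b) (a * b)) : Grown J c r (rect K L a (b + 1)) (a * (b + 1)) := by
  have key : ∀ k ≤ a, Grown J c r (rectCol K L a b k) (a * b + k) := by
    intro k
    induction k with
    | zero =>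
      intro _
      have : rectCol K L a b 0 = rect K L a b := by
        ext v; simp [rectCol, rect]
      rwa [this]
    | succ k ih =>
      intro hk
      have hins : rectCol K L a b (k + 1) =
          insert (⟨k, by omega⟩, ⟨b, hb⟩) (rectCol K L a b k) := by
        ext ⟨i, j⟩
        simp only [rectCol, Finset.mem_filter, Finset.mem_univ, true_and, Finset.mem_insert,
          Prod.mk.injEq, Fin.ext_iff]
        omega
      have hp := perimeter_rectCol_le (K := K) (L := L) (b := b) hk
      rw [hins] at hp ⊢
      exact (ih (by omega)).insert_vertex hK hL hJ22 hJ12 hr (by simp [rectCol])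
        (energy_bound_of_lineCost_le h1 h12 hc hp)
  have hrect : rectCol K L a b a = rect K L a (b + 1) := by
    ext v
    simp only [rectCol, rect, Finset.mem_filter, Finset.mem_univ, true_and]
    omega
  rw [← hrect, mul_add, mul_one]
  exact key a le_rfl

/-- With μ = γ₁₂ + γ₁/2, γ₁ · `lineCost J a b` equals a constant minus 2(μ - γ₁a)(μ - γ₁b). -/
theorem lineCost_le_of_mul_le {J : Spin → Spin → ℝ} (h1 : 0 < gamma1 J) {a b c d : ℕ}
    (h : (gamma12 J + gamma1 J / 2 - gamma1 J * c) * (gamma12 J + gamma1 J / 2 - gamma1 J * d) ≤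
      (gamma12 J + gamma1 J / 2 - gamma1 J * a) * (gamma12 J + gamma1 J / 2 - gamma1 J * b)) :
    lineCost J a b ≤ lineCost J c d := by
  unfold lineCost
  refine le_of_mul_le_mul_left ?_ h1
  nlinarith

/-- The height of the nucleation path: if `l` is the critical length then a droplet of spins `1`
can be grown to the whole torus in a sea of spins `r` below the cost of attaching a row to the
rectangle `(l - 1) × l`. -/
theorem commHeight_mono_s1_le {K L : ℕ} [NeZero K] [NeZero L] (hKL : K ≤ L) (hK : 3 ≤ K)
    {J : Spin → Spin → ℝ} (hJ22 : J s2 s2 = J s3 s3) (hJ12 : J s1 s2 = J s1 s3) {r : Spin}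
    (hr : r ≠ s1) (h1 : 0 < gamma1 J) (h12 : gamma1 J ≤ 2 * gamma12 J) {l : ℕ}
    (hlK : l + 1 ≤ K) (hl : gamma1 J * l ≤ gamma12 J + gamma1 J / 2)
    (hl' : gamma12 J + gamma1 J / 2 ≤ gamma1 J * (l + 1 : ℕ)) :
    commHeight J (mono K L r) (mono K L s1) ≤
      -(2 * K * L * J s2 s2) + lineCost J l (l + 1) := by
  have hL : 3 ≤ L := hK.trans hKL
  have h12' : 0 < gamma12 J := by linarith
  set μ := gamma12 J + gamma1 J / 2 with hμ
  -- The sides l and l + 1 straddle μ/γ₁, so their product is nonpositive. For two sides ≤ l, or two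
  -- sides ≥ l + 1, the factors agree in sign; the growth path attaches lines only to such
  -- rectangles and to l × (l + 1).
  have hneg : (μ - gamma1 J * l) * (μ - gamma1 J * (l + 1 : ℕ)) ≤ 0 :=
    mul_nonpos_of_nonneg_of_nonpos (by linarith) (by linarith)
  have hsmall : ∀ a b : ℕ, a ≤ l → b ≤ l → lineCost J a b ≤ lineCost J l (l + 1) := by
    intro a b ha hb
    apply lineCost_le_of_mul_le h1
    refine hneg.trans (mul_nonneg ?_ ?_)
    · have : gamma1 J * (a : ℝ) ≤ gamma1 J * l :=
        mul_le_mul_of_nonneg_left (by exact_mod_cast ha) h1.le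
      linarith
    · have : gamma1 J * (b : ℝ) ≤ gamma1 J * l :=
        mul_le_mul_of_nonneg_left (by exact_mod_cast hb) h1.le
      linarith
  have hlarge : ∀ a b : ℕ, l + 1 ≤ a → l + 1 ≤ b → lineCost J a b ≤ lineCost J l (l + 1) := by
    intro a b ha hb
    apply lineCost_le_of_mul_le h1
    refine hneg.trans (mul_nonneg_of_nonpos_of_nonpos ?_ ?_)
    · have : gamma1 J * ((l + 1 : ℕ) : ℝ) ≤ gamma1 J * a :=
        mul_le_mul_of_nonneg_left (by exact_mod_cast ha) h1.le
      linarith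
    · have : gamma1 J * ((l + 1 : ℕ) : ℝ) ≤ gamma1 J * b :=
        mul_le_mul_of_nonneg_left (by exact_mod_cast hb) h1.le
      linarith
  set c := -(2 * K * L * J s2 s2) + lineCost J l (l + 1) with hc
  have hrow : ∀ a b, a < K → b ≤ L → lineCost J a b ≤ lineCost J l (l + 1) →
      Grown J c r (rect K L a b) (a * b) → Grown J c r (rect K L (a + 1) b) ((a + 1) * b) :=
    fun a b ha hb h => Grown.rect_add_row hK hL hJ22 hJ12 hr h1 h12' ha hb (by linarith)
  have hcol : ∀ a b, a ≤ K → b < L → lineCost J a b ≤ lineCost J l (l + 1) →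
      Grown J c r (rect K L a b) (a * b) → Grown J c r (rect K L a (b + 1)) (a * (b + 1)) :=
    fun a b ha hb h => Grown.rect_add_col hK hL hJ22 hJ12 hr h1 h12' ha hb (by linarith)
  have hquasi : ∀ k ≤ l, Grown J c r (rect K L k (k + 1)) (k * (k + 1)) := by
    intro k
    induction k with
    | zero =>
      intro _
      have he : rect K L 0 (0 + 1) = ∅ := by ext v; simp [rect]
      refine ⟨by simp [he], ?_⟩
      rw [he, fill_empty, commHeight_le_iff]
      refine ⟨?_, .refl⟩
      rw [energy_mono hK hL hJ22 hJ12 hr]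
      have h0 := hsmall 0 0 (Nat.zero_le _) (Nat.zero_le _)
      -- This equals 2γ₁₂ - γ₁; it puts the starting configuration below the level `c`.
      have : 0 ≤ lineCost J 0 0 := by
        unfold lineCost
        push_cast
        linarith
      linarith
    | succ k ih =>
      intro hk
      have h2 := hrow k (k + 1) (by omega) (by omega) (hsmall _ _ (by omega) hk) (ih (by omega))
      exact hcol (k + 1) (k + 1) (by omega) (by omega) (hsmall _ _ hk hk) h2
  have hwide : ∀ b, l + 1 ≤ b → b ≤ L → Grown J c r (rect K L (l + 1) b) ((l + 1) * b) := by
    intro b hb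
    induction b, hb using Nat.le_induction with
    | base => exact fun _ => hrow l (l + 1) (by omega) (by omega) le_rfl (hquasi l le_rfl)
    | succ b hb ih =>
      exact fun hbL => hcol _ b hlK (by omega) (hlarge _ _ le_rfl hb) (ih (by omega))
  have htall : ∀ a, l + 1 ≤ a → a ≤ K → Grown J c r (rect K L a L) (a * L) := by
    intro a ha
    induction a, ha using Nat.le_induction with
    | base => exact fun _ => hwide L (by omega) le_rfl
    | succ a ha ih =>
      exact fun haK => hrow a L (by omega) le_rfl (hlarge _ _ ha (by omega)) (ih (by omega))
  have huniv : rect K L K L = Finset.univ := by ext v; simp [rect]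
  have := (htall K hlK le_rfl).2
  rwa [huniv, fill_univ] at this

/-! ### Lower bounds: the critical droplet and the strip. -/

/-- A set of the size of the critical droplet has at least the perimeter of the critical droplet. -/
theorem le_perimeter_of_card_eq {K L : ℕ} [NeZero K] [NeZero L] (hKL : K ≤ L) {l : ℕ}
    (hlK : 2 * l + 4 ≤ K) {S : Finset (Fin K × Fin L)} (hS : S.card = l * (l + 1) + 1) :
    4 * (l + 1) ≤ perimeter S := by
  rcases perimeter_dichotomy hKL S with ⟨h, -⟩ | ⟨p, hp, h⟩
  · omega
  · have hcard : 4 * (l * (l + 1) + 1) ≤ p ^ 2 := by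
      rcases h with h | h
      · rwa [hS] at h
      -- The complement is at least as large as `S`, so its bound implies the one for `S`.
      · have : 2 * (l * (l + 1) + 1) ≤ K * L := by nlinarith
        omega
    -- Indeed 4(l(l + 1) + 1) > (2l + 1)².
    have : 2 * l + 1 < p := by nlinarith
    omega

/-- For droplets up to the size `l * (l + 1)` the ratio of volume and perimeter is at most
`(2 * l + 1) / 8`. -/
theorem card_le_mul_perimeter {K L : ℕ} [NeZero K] [NeZero L] (hKL : K ≤ L) {l : ℕ}
    (hlK : 2 * l + 4 ≤ K) {S : Finset (Fin K × Fin L)} (hS : S.card ≤ l * (l + 1)) :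
    8 * S.card ≤ (2 * l + 1) * perimeter S := by
  -- For a long boundary, 8l(l + 1) ≤ 2(2l + 1)² suffices; for a short one, 8|S| ≤ 2p² with p ≤ 2l +
  -- 1.
  by_cases hP : 4 * l + 2 ≤ perimeter S
  · nlinarith
  rcases perimeter_dichotomy hKL S with ⟨h, -⟩ | ⟨p, hp, h⟩
  · omega
  · have hcard : 4 * S.card ≤ p ^ 2 := by
      rcases h with h | h
      · exact h
      · have : 2 * (l * (l + 1)) ≤ K * L := by nlinarith
        omega
    have : p ≤ 2 * l + 1 := by omega
    nlinarith

/-- A nonempty set of at most half of the vertices has perimeter at least four. -/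
theorem four_le_perimeter {K L : ℕ} [NeZero K] [NeZero L] (hKL : K ≤ L) (hK : 2 ≤ K)
    {S : Finset (Fin K × Fin L)} (hS : S.Nonempty) (hS' : 2 * S.card ≤ K * L) :
    4 ≤ perimeter S := by
  rcases perimeter_dichotomy hKL S with ⟨h, -⟩ | ⟨p, hp, h⟩
  · omega
  · have := hS.card_pos
    have hcard : 4 * S.card ≤ p ^ 2 := by omega
    have : 2 ≤ p := by nlinarith
    omega

/-- A set that has, together with its complement, more than `K ^ 2 / 4` elements has perimeter at
least that of a strip. -/
theorem strip_le_perimeter {K L : ℕ} [NeZero K] [NeZero L] (hKL : K ≤ L)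
    {S : Finset (Fin K × Fin L)} (hS : K ^ 2 < 4 * S.card) (hS' : K ^ 2 < 4 * (K * L - S.card)) :
    2 * K ≤ perimeter S ∧ (2 * K + 2 ≤ perimeter S ∨ K ∣ S.card) := by
  rcases perimeter_dichotomy hKL S with h | ⟨p, hp, h⟩
  · exact h
  · have : K ^ 2 < p ^ 2 := by omega
    have : K < p := lt_of_pow_lt_pow_left₀ 2 (Nat.zero_le _) this
    exact ⟨by omega, Or.inl (by omega)⟩

/-- A configuration with the size of the critical droplet has at least the critical energy. -/
theorem critical_le_energy {K L : ℕ} [NeZero K] [NeZero L] (hKL : K ≤ L)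
    {J : Spin → Spin → ℝ} (hJ22 : J s2 s2 = J s3 s3) (hJ12 : J s1 s2 = J s1 s3)
    (h1 : 0 < gamma1 J) (h12 : 0 < gamma12 J) (h23 : 0 < gamma23 J) {l : ℕ}
    (hlK : 2 * l + 4 ≤ K) {σ : Config K L} (hσ : (spinSet σ {s1}).card = l * (l + 1) + 1) :
    -(2 * K * L * J s2 s2) + lineCost J l (l + 1) ≤ energy J σ := by
  rw [energy_eq (by omega) (by omega) hJ22 hJ12, hσ]
  have hp : (4 * (l + 1) : ℝ) ≤ perimeter (spinSet σ {s1}) := by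
    exact_mod_cast le_perimeter_of_card_eq hKL hlK hσ
  have h2 : 0 ≤ gamma23 J * (((perimeter (spinSet σ {s3}) : ℝ) + perimeter (spinSet σ {s1, s3})
        - perimeter (spinSet σ {s1})) / 2) :=
    mul_nonneg h23.le (by linarith [perimeter_spinSet_le σ])
  have h3 := mul_le_mul_of_nonneg_left hp (show 0 ≤ gamma12 J + gamma1 J / 2 by positivity)
  unfold lineCost
  push_cast
  linarith

/-- Halfway between the phases `2` and `3`, a configuration with at most `l * (l + 1)` spins `1`
costs at least as much as a strip with a protuberance. -/
theorem strip_le_energy {K L : ℕ} [NeZero K] [NeZero L] (hKL : K ≤ L)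
    {J : Spin → Spin → ℝ} (hJ22 : J s2 s2 = J s3 s3) (hJ12 : J s1 s2 = J s1 s3)
    (h1 : 0 < gamma1 J) (h23 : 0 < gamma23 J) {l : ℕ} (hlK : 2 * l + 4 ≤ K)
    (hl : gamma1 J * l ≤ gamma12 J + gamma1 J / 2)
    (hC : 4 * gamma23 J + gamma1 J ≤ 2 * gamma12 J) {σ : Config K L}
    (hσ : (spinSet σ {s1}).card ≤ l * (l + 1))
    (hσ' : (spinSet σ {s3}).card = K * (K / 2) + 1) :
    -(2 * K * L * J s2 s2) + 2 * ((K : ℝ) + 1) * gamma23 J ≤ energy J σ := by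
  have hunion : (spinSet σ {s1, s3}).card =
      (spinSet σ {s1}).card + (spinSet σ {s3}).card := by
    rw [← Finset.card_union_of_disjoint]
    · congr 1
      ext v
      simp [spinSet]
    · rw [Finset.disjoint_left]
      intro v hv hv'
      simp only [spinSet, Finset.mem_filter, Finset.mem_univ, true_and,
        Finset.mem_singleton] at hv hv'
      rw [hv] at hv'
      exact absurd hv' (by decide)
  have hq : K ^ 2 < 4 * (K * (K / 2) + 1) := by
    have : K ≤ 2 * (K / 2) + 1 := by omega
    nlinarith
  have hq' : K ^ 2 < 4 * (K * L - (l * (l + 1) + (K * (K / 2) + 1))) := by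
    have h2 : 2 * (K * (K / 2)) ≤ K * K := by
      have : 2 * (K / 2) ≤ K := by omega
      nlinarith
    -- This is 2l(2l + 2) ≤ (K - 4)(K - 2).
    have h3 : 4 * (l * (l + 1)) + 6 * K ≤ K * K + 8 := by nlinarith
    have h4 : K * K ≤ K * L := Nat.mul_le_mul_left _ hKL
    rw [pow_two]
    omega
  obtain ⟨hA, hA'⟩ := strip_le_perimeter hKL (S := spinSet σ {s3}) (by omega) (by omega)
  obtain ⟨hB, -⟩ := strip_le_perimeter hKL (S := spinSet σ {s1, s3}) (by omega) (by omega)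
  have hA2 : (2 * K : ℝ) ≤ perimeter (spinSet σ {s3}) := by exact_mod_cast hA
  have hB2 : (2 * K : ℝ) ≤ perimeter (spinSet σ {s1, s3}) := by exact_mod_cast hB
  rw [energy_eq (by omega) (by omega) hJ22 hJ12]
  -- The two strip boundaries give 2Kγ₂₃; another 2γ₂₃ is needed. Without spins 1 it comes from the
  -- extra cell in K⌊K/2⌋ + 1, which breaks divisibility by K.
  rcases (spinSet σ {s1}).eq_empty_or_nonempty with he | hne
  · have h13 : spinSet σ {s1, s3} = spinSet σ {s3} := by
      symm
      apply Finset.eq_of_subset_of_card_le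
      · intro v
        simp only [spinSet, Finset.mem_filter, Finset.mem_univ, true_and, Finset.mem_insert,
          Finset.mem_singleton]
        exact Or.inr
      · rw [hunion, he, Finset.card_empty, zero_add]
    have hdvd : ¬ K ∣ (spinSet σ {s3}).card := by
      rw [hσ', Nat.dvd_add_right (Nat.dvd_mul_right _ _), Nat.dvd_one]
      omega
    have hA3 : (2 * K + 2 : ℝ) ≤ perimeter (spinSet σ {s3}) := by
      exact_mod_cast hA'.resolve_right hdvd
    rw [h13, he, perimeter_empty]
    have := mul_le_mul_of_nonneg_left hA3 h23.le
    simp only [Finset.card_empty, Nat.cast_zero]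
    linarith
  -- Otherwise the spins 1 pay: by (C) and the volume bound their net cost per unit of perimeter is
  -- at least γ₂₃/2, and their perimeter is at least 4.
  · have hp4 : 4 ≤ perimeter (spinSet σ {s1}) :=
      four_le_perimeter hKL (by omega) hne (by nlinarith)
    have hp4' : (4 : ℝ) ≤ perimeter (spinSet σ {s1}) := by exact_mod_cast hp4
    have h8 : 8 * ((spinSet σ {s1}).card : ℝ) ≤ (2 * l + 1) * perimeter (spinSet σ {s1}) := by
      exact_mod_cast card_le_mul_perimeter hKL hlK hσ
    generalize (perimeter (spinSet σ {s1}) : ℝ) = p at *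
    generalize ((spinSet σ {s1}).card : ℝ) = n at *
    have e1 : 2 * gamma1 J * n ≤ gamma1 J * (2 * l + 1) / 4 * p := by nlinarith
    have e2 : gamma23 J ≤ gamma12 J + gamma1 J / 2 - gamma1 J * (2 * l + 1) / 4 := by linarith
    have e3 := mul_le_mul_of_nonneg_right e2 (show 0 ≤ p by linarith)
    have e4 := mul_le_mul_of_nonneg_left hp4' h23.le
    have e5 := mul_le_mul_of_nonneg_left (add_le_add hA2 hB2) h23.le
    linarith

end Potts

/-! ### Assembling the three barriers. -/

open Potts in
theorem theorem3p2 (K L : ℕ) (hKL : K ≤ L) (J : Spin → Spin → ℝ)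
    (hJpos : ∀ i j, 0 < J i j)
    (hJ11 : J s2 s2 < J s1 s1) (hJ22 : J s2 s2 = J s3 s3) (hJ12 : J s1 s2 = J s1 s3)
    (hA : ¬ ∃ m : ℤ, (2 * gamma12 J + gamma1 J) / (2 * gamma1 J) = (m : ℝ))
    (hB : f (gamma1 J) (gamma12 J) = 2 * ((K : ℝ) + 1) * gamma23 J)
    (hC : 4 * gamma23 J + gamma1 J ≤ 2 * gamma12 J) :
    barrier J (mono K L s2) (mono K L s1) = gammaStar J ∧
    barrier J (mono K L s3) (mono K L s1) = gammaStar J ∧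
    barrier J (mono K L s2) (mono K L s3) = gammaStar J ∧
    gammaStar J = 2 * ((K : ℝ) + 1) * gamma23 J := by
  have h1 : 0 < gamma1 J := sub_pos.2 hJ11
  have h12 : 0 < gamma12 J := add_pos (hJpos _ _) (hJpos _ _)
  have h23 : 0 < gamma23 J := add_pos (hJpos _ _) (hJpos _ _)
  obtain ⟨l, hl⟩ : ∃ l : ℕ, ⌈(gamma12 J + gamma1 J / 2) / gamma1 J⌉ = l + 1 := by
    have : 0 < ⌈(gamma12 J + gamma1 J / 2) / gamma1 J⌉ := Int.ceil_pos.2 (by positivity)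
    exact ⟨(⌈(gamma12 J + gamma1 J / 2) / gamma1 J⌉ - 1).toNat, by omega⟩
  have hlow : gamma1 J * l < gamma12 J + gamma1 J / 2 := by
    have := (Int.ceil_eq_iff.1 hl).1
    push_cast at this
    rwa [add_sub_cancel_right, lt_div_iff₀ h1, mul_comm] at this
  have hupp : gamma12 J + gamma1 J / 2 ≤ gamma1 J * (l + 1 : ℕ) := by
    have := (Int.ceil_eq_iff.1 hl).2
    push_cast at this ⊢
    rwa [div_le_iff₀ h1, mul_comm] at this
  have hstar : gammaStar J = lineCost J l (l + 1) := by
    rw [gammaStar, f, hl, lineCost]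
    push_cast
    ring
  have hstar' : gammaStar J = 2 * ((K : ℝ) + 1) * gamma23 J := hB
  -- From γ₁l < μ, Γ* ≥ (2l + 4)γ₁₂ - γ₁l. If K + 1 ≤ 2l + 4, (B) and (C) give Γ* ≤ (2l + 4)γ₁₂ -
  -- γ₁(l + 2), a contradiction.
  have hlK : 2 * l + 4 ≤ K := by
    by_contra! hlt
    have hK : (K : ℝ) + 1 ≤ 2 * l + 4 := by exact_mod_cast hlt
    have hK' := mul_le_mul_of_nonneg_right hK h23.le
    have hC' : (2 * l + 4 : ℝ) * (4 * gamma23 J + gamma1 J) ≤ (2 * l + 4) * (2 * gamma12 J) :=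
      mul_le_mul_of_nonneg_left hC (by positivity)
    have hl0 : (0 : ℝ) ≤ l := Nat.cast_nonneg l
    have hlow' := mul_le_mul_of_nonneg_left hlow.le hl0
    rw [hstar, lineCost] at hstar'
    push_cast at hstar'
    nlinarith
  have : NeZero K := ⟨by omega⟩
  have : NeZero L := ⟨by omega⟩
  have hm2 : energy J (mono K L s2) = -(2 * K * L * J s2 s2) :=
    energy_mono (by omega) (by omega) hJ22 hJ12 (by decide)
  have hm3 : energy J (mono K L s3) = -(2 * K * L * J s2 s2) :=
    energy_mono (by omega) (by omega) hJ22 hJ12 (by decide)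
  have hup : ∀ r, r ≠ s1 → commHeight J (mono K L r) (mono K L s1) ≤
      -(2 * K * L * J s2 s2) + gammaStar J := fun r hr => hstar ▸
    commHeight_mono_s1_le hKL (by omega) hJ22 hJ12 hr h1 (by linarith) (by omega) hlow.le hupp
  have hmono : ∀ r : Spin, ∀ A : Finset Spin,
      spinSet (mono K L r) A = if r ∈ A then Finset.univ else ∅ := by
    intro r A
    split_ifs with h <;> ext v <;> simp [spinSet, mono, h]
  have hcardV : (Finset.univ : Finset (Fin K × Fin L)).card = K * L := by simp
  have hcrit : ∀ r η, r ≠ s1 → l * (l + 1) + 1 ≤ (spinSet η {s1}).card →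
      -(2 * K * L * J s2 s2) + gammaStar J ≤ commHeight J (mono K L r) η := by
    intro r η hr hη
    obtain ⟨τ, hτ, hτ'⟩ := exists_card_spinSet_eq (J := J) (σ := mono K L r) le_rfl
      (by simp [hmono, hr]) hη
    rw [hstar]
    exact (critical_le_energy hKL hJ22 hJ12 h1 h12 h23 hlK hτ).trans
      (energy_le_of_commHeight_le hτ')
  have hone : ∀ r, r ≠ s1 → commHeight J (mono K L r) (mono K L s1) =
      -(2 * K * L * J s2 s2) + gammaStar J := by
    refine fun r hr => le_antisymm (hup r hr) (hcrit r _ hr ?_)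
    rw [hmono, if_pos (by simp), hcardV]
    nlinarith
  have htwo : commHeight J (mono K L s2) (mono K L s3) =
      -(2 * K * L * J s2 s2) + gammaStar J := by
    refine le_antisymm (commHeight_le_trans (hup s2 (by decide))
      (commHeight_le_symm (hup s3 (by decide)))) ?_
    have hhalf : K * (K / 2) + 1 ≤ K * L := by
      have : K / 2 + 1 ≤ L := by omega
      nlinarith
    obtain ⟨τ, hτ, hτ'⟩ := exists_card_spinSet_eq (J := J) (σ := mono K L s2) (η := mono K L s3)
      (A := {s3}) (N := K * (K / 2) + 1) le_rfl
      (by rw [hmono, if_neg (by decide)]; simp) (by rw [hmono, if_pos (by simp), hcardV]; exact hhalf)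
    -- With this many spins 1, the part of the path up to `τ` has already crossed the critical size.
    by_cases hN : l * (l + 1) + 1 ≤ (spinSet τ {s1}).card
    · exact (hcrit s2 τ (by decide) hN).trans hτ'
    · rw [hstar']
      exact (strip_le_energy hKL hJ22 hJ12 h1 h23 hlK hlow.le hC (by omega) hτ).trans
        (energy_le_of_commHeight_le hτ')
  refine ⟨?_, ?_, ?_, hstar'⟩
  · rw [barrier, hone s2 (by decide), hm2]; ring
  · rw [barrier, hone s3 (by decide), hm3]; ring
  · rw [barrier, htwo, hm2]; ring
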